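/- Consider online delegation with $k$ proposals. There are $n$ rounds; in each round an option is drawn independently from a known finite distribution $\mathcal D$, and an option $\omega$ has utility $b(\omega)\ge 0$ for the principal and $a(\omega)\ge 0$ for the agent. The principal first commits to a deterministic history-dependent action scheme: for every round $i$, every history $H_i=(h_1,\dots,h_{i-1})$, where $h_r$ records whether a proposal was made in round $r$ and, if so, which option was proposed, and every option $\omega$, it fixes $\varphi_i(H_i,\omega)\in\{0,1\}$, saying whether $\omega$ is accepted when it is proposed in round $i$ after history $H_i$. The agent, knowing $\varphi$ and $\mathcal D$, sees the drawn options one after the other and decides immediately and irrevocably, by a deterministic strategy that may depend on all options drawn so far, whether to propose the current one. The game ends when a proposal is accepted, when the $k$-th proposal has been made, or after round $n$; if an option $\omega$ is accepted, the utilities $b(\omega)$ and $a(\omega)$ are realized, otherwise both utilities are $0$. The agent plays a strategy that maximizes his expected utility given $\varphi$. For $n\ge 1$ let $\mathcal I_n$ be the IID instance with $n$ rounds in which, in each round, the principal's and the agent's utility are drawn independently: $b=1$ with probability $1/n$ and $b=0$ with probability $1-1/n$, and $a=n^{4\ell}$ with probability $1/n$ for each $\ell=1,\dots,n$. Let $\mathrm{OPT}_n=\mathbb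 E[\max_{i\le n} b(O_i)]$ be the expected utility of the principal for optimal (non-delegated) offline search on $\mathcal I_n$, where $O_i$ is the option drawn in round $i$. **Theorem.** There is an absolute constant $C>0$ such that for all integers $n\ge 1$ and $k\ge 1$, on $\mathcal I_n$ with $k$ proposals, for every deterministic history-dependent action scheme $\varphi$ and every best response of the agent to $\varphi$ (in particular for one that breaks ties in favor of the principal), the expected utility of the principal is at most $C\cdot\frac{k}{n}\cdot\mathrm{OPT}_n$. -/

import Mathlib

noncomputable section

namespace OnlineDelegation

/-- An instance of online delegation in the IID setting, with finite option set `Ω`: in each of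
`n` rounds an option is drawn independently according to the weights `prob`.  An accepted
option `o` is worth `agentUtil o` to the agent and `principalUtil o` to the principal. -/
structure IIDInstance (n : ℕ) (Ω : Type*) [Fintype Ω] where
  prob : Ω → ℝ
  agentUtil : Ω → ℝ
  principalUtil : Ω → ℝ
  prob_nonneg : ∀ o, 0 ≤ prob o
  sum_prob : ∑ o, prob o = 1
  agentUtil_nonneg : ∀ o, 0 ≤ agentUtil o
  principalUtil_nonneg : ∀ o, 0 ≤ principalUtil o

/-- What the principal has observed before the current round, most recent round first: for each
past round, `none` if there was no proposal and `some o` if option `o` was proposed.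
The current round is the length of the history plus one. -/
abbrev History (Ω : Type*) := List (Option Ω)

/-- A deterministic history-dependent action scheme: `φ H o` says whether the principal accepts
option `o` when it is proposed after history `H`. -/
abbrev Scheme (Ω : Type*) := History Ω → Ω → Bool

/-- A (deterministic, online) proposal strategy of the agent: `σ D o` says whether the agent
proposes the current option `o` when the options drawn in the earlier rounds
(most recent first, proposed or not) are `D`. -/
abbrev Strategy (Ω : Type*) := List Ω → Ω → Bool

/-- The option finally accepted, if any, when the agent has `k` proposals left, the history is `H`,
the past draws are `D`, and the last argument lists the options drawn in the current and the
later rounds in chronological order. -/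
def acceptedFrom {Ω : Type*} (φ : Scheme Ω) (σ : Strategy Ω) :
    ℕ → History Ω → List Ω → List Ω → Option Ω
  | _, _, _, [] => none
  | 0, _, _, _ :: _ => none
  | k + 1, H, D, o :: os =>
    if σ D o then
      if φ H o then some o
      else acceptedFrom φ σ k (some o :: H) (o :: D) os
    else acceptedFrom φ σ (k + 1) (none :: H) (o :: D) os

/-- The option finally accepted, if any, with `k` proposals, when the draws are `ω`. -/
def accepted {Ω : Type*} {n : ℕ} (k : ℕ) (φ : Scheme Ω) (σ : Strategy Ω) (ω : Fin n → Ω) :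
    Option Ω :=
  acceptedFrom φ σ k [] [] (List.ofFn ω)

namespace IIDInstance

variable {n : ℕ} {Ω : Type*} [Fintype Ω] (I : IIDInstance n Ω)

/-- Expectation over the independent draws of all rounds. -/
def expect (X : (Fin n → Ω) → ℝ) : ℝ :=
  ∑ ω : Fin n → Ω, (∏ i, I.prob (ω i)) * X ω

/-- Expected utility of the agent; it is `0` on the event that no option is accepted. -/
def agentValue (k : ℕ) (φ : Scheme Ω) (σ : Strategy Ω) : ℝ :=
  I.expect fun ω => (accepted k φ σ ω).elim 0 I.agentUtil

/-- Expected utility of the principal; it is `0` on the event that no option is accepted. -/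
def principalValue (k : ℕ) (φ : Scheme Ω) (σ : Strategy Ω) : ℝ :=
  I.expect fun ω => (accepted k φ σ ω).elim 0 I.principalUtil

/-- `σ` is a best response of the agent to the scheme `φ` (to which the principal commits). -/
def IsBestResponse (k : ℕ) (φ : Scheme Ω) (σ : Strategy Ω) : Prop :=
  ∀ τ : Strategy Ω, I.agentValue k φ τ ≤ I.agentValue k φ σ

/-- Expected utility of the principal under optimal (non-delegated) offline search. -/
def offlineValue : ℝ :=
  I.expect fun ω => ⨆ i, I.principalUtil (ω i)

/-- Best responses exist, and so do best responses that break ties in favour of the principal. -/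
theorem exists_isBestResponse (k : ℕ) (φ : Scheme Ω) :
    ∃ σ, I.IsBestResponse k φ σ ∧
      ∀ τ, I.IsBestResponse k φ τ → I.principalValue k φ τ ≤ I.principalValue k φ σ := by
  classical
  let out : Strategy Ω → ((Fin n → Ω) → Option Ω) := fun σ ω => accepted k φ σ ω
  let val : (Ω → ℝ) → ((Fin n → Ω) → Option Ω) → ℝ :=
    fun u g => I.expect fun ω => (g ω).elim 0 u
  obtain ⟨g, ⟨σ, rfl⟩, hg⟩ := Set.exists_max_image (Set.range out) (val I.agentUtil)
    (Set.toFinite _) ⟨_, fun _ _ => true, rfl⟩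
  have hσ : I.IsBestResponse k φ σ := fun τ => hg _ ⟨τ, rfl⟩
  obtain ⟨g', ⟨σ', hσ', rfl⟩, hg'⟩ := Set.exists_max_image (out '' {τ | I.IsBestResponse k φ τ})
    (val I.principalUtil) (Set.toFinite _) ⟨_, σ, hσ, rfl⟩
  exact ⟨σ', hσ', fun τ hτ => hg' _ ⟨τ, hτ, rfl⟩⟩

end IIDInstance

/-- The instance with `n` rounds and `2 * n` options in which both utilities are drawn
independently: the principal's utility is `1` with probability `1 / n` and `0` otherwise
(first component `true` or `false`), and the agent's utility is uniform on `n ^ (4 * l)`,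
`l = 1, …, n` (the second component is `l - 1`). -/
def hardInstance (n : ℕ) (hn : 1 ≤ n) : IIDInstance n (Bool × Fin n) where
  prob o := (if o.1 then 1 / (n : ℝ) else 1 - 1 / (n : ℝ)) * (1 / (n : ℝ))
  agentUtil o := (n : ℝ) ^ (4 * ((o.2 : ℕ) + 1))
  principalUtil o := if o.1 then 1 else 0
  prob_nonneg o := by
    have h1 : (1 : ℝ) ≤ n := by exact_mod_cast hn
    have h2 : 1 / (n : ℝ) ≤ 1 := by rw [div_le_one (by linarith)]; exact h1
    refine mul_nonneg ?_ (by positivity)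
    split_ifs
    · positivity
    · linarith
  sum_prob := by
    have h1 : (n : ℝ) ≠ 0 := by exact_mod_cast (by omega : n ≠ 0)
    rw [Fintype.sum_prod_type]
    simp
    field_simp
    ring
  agentUtil_nonneg o := by positivity
  principalUtil_nonneg o := by split_ifs <;> norm_num

end OnlineDelegation

end

/-! Since `OPT_n ≥ 1/2`, it suffices to bound the principal's value by `2 * k / n`. Let `v` be the
agent's optimal value now and `v'` his optimal value after staying silent. A good option he gets
accepted now has agent utility at least `v'`, as otherwise silence is better, and at most `n ^ 2 *
v`, as he could wait for that single option of probability `1 / n ^ 2`. Agent utilities are spaced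
by factors `n ^ 4`, so the number of such options is at most one plus the drop in the number of
levels below `n ^ 2` times the agent's value.

Each such option is drawn with probability `1 / n ^ 2`. While the agent stays silent the drops
telescope, costing at most `(n + n) / n ^ 2 = 2 / n` in total. A rejected proposal may raise the
agent's value again and restart the count, but uses up one of the `k` proposals. The induction is
`principalValueFrom_le`; `card_add_card_levels_le` does the counting, and
`choice_eq_max_of_valueFrom_eq` passes optimality on to later states. -/

open Finset

namespace OnlineDelegation

namespace IIDInstance

/-! ### Dynamic programming for the agent, on an arbitrary instance. -/

section General

variable {n : ℕ} {Ω : Type*} [Fintype Ω] (I : IIDInstance n Ω) (φ : Scheme Ω)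

/-- Expected utility with respect to `u` of the option finally accepted, when `m` rounds and `k`
proposals are left, the history is `H` and the past draws are `D`. -/
noncomputable def valueFrom (u : Ω → ℝ) (σ : Strategy Ω) (m k : ℕ) (H : History Ω)
    (D : List Ω) : ℝ :=
  ∑ ω : Fin m → Ω, (∏ i, I.prob (ω i)) * (acceptedFrom φ σ k H D (List.ofFn ω)).elim 0 u

theorem valueFrom_rounds_zero (u : Ω → ℝ) (σ : Strategy Ω) (k : ℕ) (H : History Ω) (D : List Ω) :
    I.valueFrom φ u σ 0 k H D = 0 := by
  simp [valueFrom, acceptedFrom]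

theorem valueFrom_proposals_zero (u : Ω → ℝ) (σ : Strategy Ω) (m : ℕ) (H : History Ω)
    (D : List Ω) : I.valueFrom φ u σ m 0 H D = 0 := by
  cases m <;> simp [valueFrom, acceptedFrom, List.ofFn_succ]

theorem sum_prod_prob (m : ℕ) : ∑ ω : Fin m → Ω, ∏ i, I.prob (ω i) = 1 := by
  have h := Fintype.sum_pow I.prob m
  rw [I.sum_prob, one_pow] at h
  exact h.symm

theorem sum_fin_succ (m : ℕ) (f : (Fin (m + 1) → Ω) → ℝ) :
    ∑ ω, f ω = ∑ o, ∑ ω : Fin m → Ω, f (Fin.cons o ω) := by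
  rw [← Fintype.sum_prod_type']
  exact (Fintype.sum_equiv (Fin.consEquiv fun _ => Ω) _ _ fun _ => rfl).symm

theorem valueFrom_succ (u : Ω → ℝ) (σ : Strategy Ω) (m k : ℕ) (H : History Ω) (D : List Ω) :
    I.valueFrom φ u σ (m + 1) (k + 1) H D = ∑ o, I.prob o *
      (if σ D o then (if φ H o then u o else I.valueFrom φ u σ m k (some o :: H) (o :: D))
        else I.valueFrom φ u σ m (k + 1) (none :: H) (o :: D)) := by
  rw [valueFrom, sum_fin_succ]
  refine Finset.sum_congr rfl fun o _ => ?_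
  simp only [Fin.prod_univ_succ, Fin.cons_zero, Fin.cons_succ, List.ofFn_succ, acceptedFrom,
    mul_assoc]
  rw [← Finset.mul_sum]
  congr 1
  split_ifs
  · simp [← Finset.sum_mul, I.sum_prod_prob]
  · rfl
  · rfl

/-- Optimal expected utility of the agent when `m` rounds and `k` proposals are left and the
history is `H`. -/
noncomputable def optValue : ℕ → ℕ → History Ω → ℝ
  | 0, _, _ => 0
  | _ + 1, 0, _ => 0
  | m + 1, k + 1, H => ∑ o, I.prob o *
      max (if φ H o then I.agentUtil o else optValue m k (some o :: H))
        (optValue m (k + 1) (none :: H))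

theorem optValue_proposals_zero (m : ℕ) (H : History Ω) : I.optValue φ m 0 H = 0 := by
  cases m <;> rfl

theorem optValue_nonneg (m k : ℕ) (H : History Ω) : 0 ≤ I.optValue φ m k H := by
  induction m generalizing k H with
  | zero => rw [optValue]
  | succ m ih =>
    cases k with
    | zero => rw [optValue]
    | succ k =>
      rw [optValue]
      exact Finset.sum_nonneg fun o _ =>
        mul_nonneg (I.prob_nonneg o) ((ih _ _).trans (le_max_right _ _))

theorem optValue_skip_le (m k : ℕ) (H : History Ω) :
    I.optValue φ m (k + 1) (none :: H) ≤ I.optValue φ (m + 1) (k + 1) H := by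
  rw [optValue]
  calc _ = ∑ o, I.prob o * I.optValue φ m (k + 1) (none :: H) := by
        rw [← Finset.sum_mul, I.sum_prob, one_mul]
    _ ≤ _ := Finset.sum_le_sum fun o _ =>
        mul_le_mul_of_nonneg_left (le_max_right _ _) (I.prob_nonneg o)

/-- Hoping for `o` alone in the current round is one of the agent's options, and all other draws
contribute nonnegatively. -/
theorem prob_mul_agentUtil_le_optValue (m k : ℕ) (H : History Ω) (o : Ω) (h : φ H o = true) :
    I.prob o * I.agentUtil o ≤ I.optValue φ (m + 1) (k + 1) H := by
  rw [optValue]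
  refine le_trans ?_ (Finset.single_le_sum (f := fun o => I.prob o *
      max (if φ H o then I.agentUtil o else I.optValue φ m k (some o :: H))
        (I.optValue φ m (k + 1) (none :: H))) (fun o _ => mul_nonneg (I.prob_nonneg o)
          ((I.optValue_nonneg φ _ _ _).trans (le_max_right _ _))) (Finset.mem_univ o))
  simp only [h, if_true]
  exact mul_le_mul_of_nonneg_left (le_max_left _ _) (I.prob_nonneg o)

theorem choice_le_max {b c : Bool} {x y z y' z' : ℝ} (hy : y ≤ y') (hz : z ≤ z') :
    (if b then (if c then x else y) else z) ≤ max (if c then x else y') z' := by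
  cases b <;> cases c <;> simp [hy, hz]

theorem valueFrom_agentUtil_le_optValue (σ : Strategy Ω) (m k : ℕ) (H : History Ω) (D : List Ω) :
    I.valueFrom φ I.agentUtil σ m k H D ≤ I.optValue φ m k H := by
  induction m generalizing k H D with
  | zero => rw [valueFrom_rounds_zero, optValue]
  | succ m ih =>
    cases k with
    | zero => rw [valueFrom_proposals_zero, optValue]
    | succ k =>
      rw [valueFrom_succ, optValue]
      exact Finset.sum_le_sum fun o _ =>
        mul_le_mul_of_nonneg_left (choice_le_max (ih _ _ _) (ih _ _ _)) (I.prob_nonneg o)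

/-- Whether proposing `o` is optimal for the agent in a state with `m` later rounds. -/
noncomputable def greedyChoice (m : ℕ) (s : ℕ × History Ω) (o : Ω) : Bool :=
  decide (I.optValue φ m s.1 (none :: s.2) ≤
    if φ s.2 o then I.agentUtil o else I.optValue φ m (s.1 - 1) (some o :: s.2))

/-- Remaining proposals and history after the draws `D` when the agent plays greedily. -/
noncomputable def greedyState (N k : ℕ) : List Ω → ℕ × History Ω
  | [] => (k, [])
  | o :: D =>
    if I.greedyChoice φ (N - (D.length + 1)) (greedyState N k D) o then
      ((greedyState N k D).1 - 1, some o :: (greedyState N k D).2)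
    else ((greedyState N k D).1, none :: (greedyState N k D).2)

/-- The strategy obtained from `optValue` by backward induction. -/
noncomputable def greedyStrategy (N k : ℕ) : Strategy Ω := fun D o =>
  I.greedyChoice φ (N - (D.length + 1)) (I.greedyState φ N k D) o

/-- A strategy sees only the draws, so the greedy one must recompute proposals and history from `D`.
The hypothesis `hs`, that this recomputed state is the true one, is preserved as long as nothing has
been accepted. -/
theorem optValue_le_valueFrom_greedyStrategy (N k₀ m k : ℕ) (H : History Ω) (D : List Ω)
    (hD : D.length + m = N) (hs : I.greedyState φ N k₀ D = (k, H)) :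
    I.optValue φ m k H ≤ I.valueFrom φ I.agentUtil (I.greedyStrategy φ N k₀) m k H D := by
  induction m generalizing k H D with
  | zero => rw [valueFrom_rounds_zero, optValue]
  | succ m ih =>
    cases k with
    | zero => rw [valueFrom_proposals_zero, optValue]
    | succ k =>
      rw [valueFrom_succ, optValue]
      refine Finset.sum_le_sum fun o _ => mul_le_mul_of_nonneg_left ?_ (I.prob_nonneg o)
      have hm : N - (D.length + 1) = m := by omega
      have hσ : I.greedyStrategy φ N k₀ D o = I.greedyChoice φ m (k + 1, H) o := by
        rw [greedyStrategy, hm, hs]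
      have hl : (o :: D).length + m = N := by simp only [List.length_cons]; omega
      have hst : I.greedyState φ N k₀ (o :: D) =
          if I.greedyChoice φ m (k + 1, H) o then (k, some o :: H)
          else (k + 1, none :: H) := by
        rw [greedyState, hm, hs]; rfl
      rw [hσ]
      by_cases hc : I.greedyChoice φ m (k + 1, H) o = true
      · rw [if_pos hc] at hst ⊢
        simp only [greedyChoice, decide_eq_true_eq, Nat.add_sub_cancel] at hc
        rw [max_eq_left hc]
        split_ifs with h
        · exact le_rfl
        · exact ih _ _ _ hl hst
      · rw [if_neg hc] at hst ⊢
        simp only [greedyChoice, decide_eq_true_eq, Nat.add_sub_cancel] at hc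
        rw [max_eq_right (not_le.mp hc).le]
        exact ih _ _ _ hl hst

variable {I φ} in
theorem IsBestResponse.valueFrom_eq_optValue {k : ℕ} {σ : Strategy Ω}
    (h : I.IsBestResponse k φ σ) :
    I.valueFrom φ I.agentUtil σ n k [] [] = I.optValue φ n k [] :=
  le_antisymm (I.valueFrom_agentUtil_le_optValue φ σ n k [] [])
    ((I.optValue_le_valueFrom_greedyStrategy φ n k n k [] [] (by simp) rfl).trans
      (h (I.greedyStrategy φ n k)))

/-- If the agent plays optimally from a state on, then so he does after every possible draw. -/
theorem choice_eq_max_of_valueFrom_eq (hp : ∀ o, 0 < I.prob o) {σ : Strategy Ω} {m k : ℕ}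
    {H : History Ω} {D : List Ω}
    (h : I.valueFrom φ I.agentUtil σ (m + 1) (k + 1) H D = I.optValue φ (m + 1) (k + 1) H)
    (o : Ω) :
    (if σ D o then (if φ H o then I.agentUtil o
        else I.valueFrom φ I.agentUtil σ m k (some o :: H) (o :: D))
      else I.valueFrom φ I.agentUtil σ m (k + 1) (none :: H) (o :: D)) =
    max (if φ H o then I.agentUtil o else I.optValue φ m k (some o :: H))
        (I.optValue φ m (k + 1) (none :: H)) := by
  rw [valueFrom_succ, optValue] at h
  -- The sums agree and are ordered termwise, so the terms agree; the positive weight then cancels.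
  have := (Finset.sum_eq_sum_iff_of_le fun o _ => mul_le_mul_of_nonneg_left
    (choice_le_max (b := σ D o) (c := φ H o) (x := I.agentUtil o)
      (I.valueFrom_agentUtil_le_optValue φ σ m k (some o :: H) (o :: D))
      (I.valueFrom_agentUtil_le_optValue φ σ m (k + 1) (none :: H) (o :: D)))
    (I.prob_nonneg o)).mp h o (Finset.mem_univ o)
  exact mul_left_cancel₀ (hp o).ne' this

end General

end IIDInstance

/-! ### The hard instance: counting levels and the potential argument. -/

section Hard

variable {n : ℕ} (hn : 1 ≤ n)

/-- The levels whose agent utility is at most `n ^ 2 * v`. -/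
noncomputable def levels (n : ℕ) (v : ℝ) : Finset (Fin n) :=
  univ.filter fun j => (n : ℝ) ^ (4 * ((j : ℕ) + 1)) ≤ v * (n : ℝ) ^ 2

theorem card_levels_le (v : ℝ) : (levels n v).card ≤ n := by
  simpa using Finset.card_le_univ (levels n v)

/-- The agent utilities between `v'` and `n ^ 2 * v` are paid for by a drop of the number of
levels. -/
theorem card_add_card_levels_le (h2 : 2 ≤ n) {v v' : ℝ} (hv : v' ≤ v) (hv' : 0 ≤ v')
    (S : Finset (Fin n)) (hS : ∀ j ∈ S, j ∈ levels n v ∧ v' ≤ (n : ℝ) ^ (4 * ((j : ℕ) + 1))) :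
    S.card + (levels n v').card ≤ (levels n v).card + 1 := by
  classical
  have hn2 : (2 : ℝ) ≤ n := by exact_mod_cast h2
  set B := univ.filter fun j : Fin n => (n : ℝ) ^ (4 * ((j : ℕ) + 1)) < v' with hB
  have h1 : S.card + B.card ≤ (levels n v).card := by
    rw [← Finset.card_union_of_disjoint]
    · refine Finset.card_le_card fun j hj => ?_
      rcases Finset.mem_union.mp hj with hj | hj
      · exact (hS j hj).1
      · have hj' : (n : ℝ) ^ (4 * ((j : ℕ) + 1)) < v' := by simpa [hB] using hj
        simp only [levels, mem_filter, mem_univ, true_and]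
        nlinarith [mul_nonneg (hv'.trans hv) (by nlinarith : (0 : ℝ) ≤ (n : ℝ) ^ 2 - 1)]
    · rw [Finset.disjoint_left]
      intro j hj hj'
      exact absurd (hS j hj).2 (not_le.mpr (by simpa [hB] using hj'))
  -- At most one level lies between `v'` and `n ^ 2 * v'`: by the spacing `n ^ 4`, anything below
  -- another level of `levels n v'` is already below `v'`.
  have hlt : ∀ i j : Fin n, i < j → j ∈ levels n v' → i ∈ B := by
    intro i j hij hj
    simp only [levels, mem_filter, mem_univ, true_and] at hj
    simp only [hB, mem_filter, mem_univ, true_and]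
    have hpow : (n : ℝ) ^ (4 * ((i : ℕ) + 1)) * (n : ℝ) ^ 4 ≤ (n : ℝ) ^ (4 * ((j : ℕ) + 1)) := by
      rw [← pow_add]
      exact pow_le_pow_right₀ (by linarith) (by have := Fin.lt_def.mp hij; omega)
    have hpos : 0 < (n : ℝ) ^ (4 * ((i : ℕ) + 1)) := by positivity
    have hle : (n : ℝ) ^ (4 * ((i : ℕ) + 1)) * (n : ℝ) ^ 2 ≤ v' := by
      refine le_of_mul_le_mul_right ?_ (by positivity : (0 : ℝ) < (n : ℝ) ^ 2)
      calc _ = (n : ℝ) ^ (4 * ((i : ℕ) + 1)) * (n : ℝ) ^ 4 := by ring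
        _ ≤ _ := hpow.trans hj
    nlinarith [mul_pos hpos (by nlinarith : (0 : ℝ) < (n : ℝ) ^ 2 - 1)]
  have h3 : (levels n v' \ B).card ≤ 1 := by
    rw [Finset.card_le_one]
    intro i hi j hj
    rw [Finset.mem_sdiff] at hi hj
    rcases lt_trichotomy i j with h | h | h
    · exact absurd (hlt i j h hj.1) hi.2
    · exact h
    · exact absurd (hlt j i h hi.1) hj.2
  have h4 : (levels n v').card ≤ (levels n v' \ B).card + B.card :=
    tsub_le_iff_right.mp (Finset.le_card_sdiff B (levels n v'))
  omega

theorem hardInstance_prob_pos (h2 : 2 ≤ n) (o : Bool × Fin n) :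
    0 < (hardInstance n hn).prob o := by
  have hn2 : (2 : ℝ) ≤ n := by exact_mod_cast h2
  have h : 1 / (n : ℝ) < 1 := by rw [div_lt_one (by linarith)]; linarith
  have : 0 < 1 / (n : ℝ) := by positivity
  simp only [hardInstance]
  split_ifs
  · positivity
  · exact mul_pos (by linarith) this

theorem hardInstance_prob_true (j : Fin n) :
    (hardInstance n hn).prob (true, j) = 1 / (n : ℝ) ^ 2 := by
  simp only [hardInstance, if_true]
  rw [div_mul_div_comm, one_mul, sq]

theorem mem_levels_of_accepted {φ : Scheme (Bool × Fin n)} {m k : ℕ}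
    {H : History (Bool × Fin n)} {j : Fin n} (h : φ H (true, j) = true) :
    j ∈ levels n ((hardInstance n hn).optValue φ (m + 1) (k + 1) H) := by
  have hn0 : (0 : ℝ) < n := by exact_mod_cast hn
  have := (hardInstance n hn).prob_mul_agentUtil_le_optValue φ m k H (true, j) h
  rw [hardInstance_prob_true, one_div_mul_eq_div, div_le_iff₀ (by positivity)] at this
  simp only [levels, mem_filter, mem_univ, true_and]
  exact this

/-- Along optimal play of the agent, an acceptance that is good for the principal is paid for by
the levels and rounds that are left, and every rejected proposal costs at most `2 / n`. -/
theorem principalValueFrom_le (h2 : 2 ≤ n) (φ : Scheme (Bool × Fin n))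
    (σ : Strategy (Bool × Fin n)) (m k : ℕ) (hm : m ≤ n) (H : History (Bool × Fin n))
    (D : List (Bool × Fin n))
    (h : (hardInstance n hn).valueFrom φ (hardInstance n hn).agentUtil σ m (k + 1) H D =
      (hardInstance n hn).optValue φ m (k + 1) H) :
    (hardInstance n hn).valueFrom φ (hardInstance n hn).principalUtil σ m (k + 1) H D ≤
      (((levels n ((hardInstance n hn).optValue φ m (k + 1) H)).card : ℝ) + m) / (n : ℝ) ^ 2 +
        2 * k / n := by
  set I := hardInstance n hn with hI
  have hn0 : (0 : ℝ) < n := by exact_mod_cast hn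
  induction m generalizing k H D with
  | zero =>
    rw [IIDInstance.valueFrom_rounds_zero]
    positivity
  | succ m ih =>
    have hopt := I.choice_eq_max_of_valueFrom_eq φ (hardInstance_prob_pos hn h2) h
    set v := I.optValue φ (m + 1) (k + 1) H with hv
    set v' := I.optValue φ m (k + 1) (none :: H) with hv'
    -- `R` is the bound for the state after silence.
    set R : ℝ := (((levels n v').card : ℝ) + m) / (n : ℝ) ^ 2 + 2 * k / n with hR
    have hR0 : 0 ≤ R := by positivity
    have hterm : ∀ o, (if σ D o then (if φ H o then I.principalUtil o
          else I.valueFrom φ I.principalUtil σ m k (some o :: H) (o :: D))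
        else I.valueFrom φ I.principalUtil σ m (k + 1) (none :: H) (o :: D)) ≤
        (if σ D o && φ H o then I.principalUtil o else 0) + R := by
      intro o
      have ho := hopt o
      by_cases hs : σ D o = true
      · by_cases hf : φ H o = true
        · simp [hs, hf, hR0]
        · simp only [hs, hf, if_true, Bool.and_false, Bool.false_eq_true, if_false, zero_add]
            at ho ⊢
          cases k with
          | zero => rw [IIDInstance.valueFrom_proposals_zero]; exact hR0
          | succ k =>
            have heq : I.valueFrom φ I.agentUtil σ m (k + 1) (some o :: H) (o :: D) =
                I.optValue φ m (k + 1) (some o :: H) :=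
              le_antisymm (I.valueFrom_agentUtil_le_optValue φ _ _ _ _ _)
                ((le_max_left _ _).trans ho.ge)
            refine (ih k (by omega) _ _ heq).trans ?_
            -- After a rejection nothing is known about the new value, so the potential is bounded
            -- crudely by `2 * n / n ^ 2 = 2 / n`, paid for by the proposal just used.
            have hc : ((levels n (I.optValue φ m (k + 1) (some o :: H))).card : ℝ) ≤ n := by
              exact_mod_cast card_levels_le _
            have hm' : (m : ℝ) ≤ n := by exact_mod_cast (by omega : m ≤ n)
            have h1 : (((levels n (I.optValue φ m (k + 1) (some o :: H))).card : ℝ) + m) /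
                (n : ℝ) ^ 2 ≤ 2 / n := by
              rw [div_le_div_iff₀ (by positivity) hn0]
              nlinarith
            have h3 : 2 * ((k + 1 : ℕ) : ℝ) / n = 2 / n + 2 * k / n := by push_cast; ring
            have h4 : 0 ≤ (((levels n v').card : ℝ) + m) / (n : ℝ) ^ 2 := by positivity
            rw [hR, h3]
            linarith
      · simp only [hs, Bool.false_and, Bool.false_eq_true, if_false, zero_add] at ho ⊢
        exact ih k (by omega) _ _ (le_antisymm (I.valueFrom_agentUtil_le_optValue φ _ _ _ _ _)
          ((le_max_right _ _).trans ho.ge))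
    let S : Finset (Fin n) := univ.filter fun j => (σ D (true, j) && φ H (true, j)) = true
    have hS : S.card + (levels n v').card ≤ (levels n v).card + 1 := by
      refine card_add_card_levels_le h2 (I.optValue_skip_le φ m k H)
        (I.optValue_nonneg φ _ _ _) S fun j hj => ?_
      have hj' : σ D (true, j) = true ∧ φ H (true, j) = true := by simpa [S] using hj
      refine ⟨mem_levels_of_accepted hn hj'.2, ?_⟩
      have ho := hopt (true, j)
      simp only [hj'.1, hj'.2, if_true] at ho
      exact (le_max_right _ _).trans ho.ge
    have hsum : ∑ o, I.prob o * (if σ D o && φ H o then I.principalUtil o else 0) =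
        S.card / (n : ℝ) ^ 2 := by
      rw [Fintype.sum_prod_type, Fintype.sum_bool]
      have hfalse : ∀ j : Fin n, I.prob (false, j) *
          (if σ D (false, j) && φ H (false, j) then I.principalUtil (false, j) else 0) = 0 := by
        intro j; simp [hI, hardInstance]
      have htrue : ∀ j : Fin n, I.prob (true, j) *
          (if σ D (true, j) && φ H (true, j) then I.principalUtil (true, j) else 0) =
          if j ∈ S then 1 / (n : ℝ) ^ 2 else 0 := by
        intro j
        rw [hI, hardInstance_prob_true]
        simp [S, hardInstance]
      rw [Finset.sum_congr rfl fun j _ => hfalse j, Finset.sum_congr rfl fun j _ => htrue j,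
        Finset.sum_ite_mem]
      simp [div_eq_mul_inv]
    rw [IIDInstance.valueFrom_succ]
    -- The surplus `1` is absorbed by the round that passes, from `m + 1` to `m`.
    have hS' : (S.card : ℝ) + (levels n v').card ≤ (levels n v).card + 1 := by exact_mod_cast hS
    calc _ ≤ ∑ o, I.prob o * ((if σ D o && φ H o then I.principalUtil o else 0) + R) :=
          Finset.sum_le_sum fun o _ => mul_le_mul_of_nonneg_left (hterm o) (I.prob_nonneg o)
      _ = S.card / (n : ℝ) ^ 2 + R := by
          simp only [mul_add]
          rw [Finset.sum_add_distrib, hsum, ← Finset.sum_mul, I.sum_prob, one_mul]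
      _ = (S.card + (levels n v').card + m) / (n : ℝ) ^ 2 + 2 * k / n := by rw [hR]; ring
      _ ≤ _ := by
          push_cast
          gcongr ?_ / _ + _
          linarith

theorem principalValue_le (h2 : 2 ≤ n) {k : ℕ} (hk : 1 ≤ k) {φ : Scheme (Bool × Fin n)}
    {σ : Strategy (Bool × Fin n)} (h : (hardInstance n hn).IsBestResponse k φ σ) :
    (hardInstance n hn).principalValue k φ σ ≤ 2 * k / n := by
  obtain ⟨k, rfl⟩ := Nat.exists_eq_add_of_le' hk
  have hn0 : (0 : ℝ) < n := by exact_mod_cast hn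
  refine (principalValueFrom_le hn h2 φ σ n k le_rfl [] [] h.valueFrom_eq_optValue).trans ?_
  have hc : ((levels n ((hardInstance n hn).optValue φ n (k + 1) [])).card : ℝ) ≤ n := by
    exact_mod_cast card_levels_le _
  have h1 : (((levels n ((hardInstance n hn).optValue φ n (k + 1) [])).card : ℝ) + n) /
      (n : ℝ) ^ 2 ≤ 2 / n := by
    rw [div_le_div_iff₀ (by positivity) hn0]
    nlinarith
  have h3 : 2 * ((k + 1 : ℕ) : ℝ) / n = 2 / n + 2 * k / n := by push_cast; ring
  rw [h3]
  linarith

/-! ### The trivial bound and the offline benchmark. -/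

theorem principalValue_le_one (k : ℕ) (φ : Scheme (Bool × Fin n))
    (σ : Strategy (Bool × Fin n)) : (hardInstance n hn).principalValue k φ σ ≤ 1 := by
  have hle : ∀ x : Option (Bool × Fin n), x.elim 0 (hardInstance n hn).principalUtil ≤ 1 := by
    rintro (_ | o)
    · exact zero_le_one
    · simp only [Option.elim_some, hardInstance]
      split_ifs <;> norm_num
  rw [← (hardInstance n hn).sum_prod_prob n]
  exact Finset.sum_le_sum fun ω _ => mul_le_of_le_one_right
    (Finset.prod_nonneg fun i _ => (hardInstance n hn).prob_nonneg _) (hle _)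

/-- The maximum of 0-1 utilities is `1 - ∏ (1 - b)`, and independence turns its expectation into `1
- (1 - 1 / n) ^ n ≥ 1 - 1 / e`. -/
theorem half_le_offlineValue : 1 / 2 ≤ (hardInstance n hn).offlineValue := by
  set I := hardInstance n hn with hI
  have hn1 : (1 : ℝ) ≤ n := by exact_mod_cast hn
  have hsup : ∀ ω : Fin n → Bool × Fin n,
      1 - ∏ i, (1 - I.principalUtil (ω i)) ≤ ⨆ i, I.principalUtil (ω i) := by
    intro ω
    by_cases hω : ∃ i, (ω i).1 = true
    · obtain ⟨i, hi⟩ := hω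
      have h1 : I.principalUtil (ω i) = 1 := by simp [hI, hardInstance, hi]
      rw [Finset.prod_eq_zero (Finset.mem_univ i) (by rw [h1, sub_self]), sub_zero, ← h1]
      exact le_ciSup (f := fun i => I.principalUtil (ω i)) (Set.finite_range _).bddAbove i
    · push Not at hω
      have h0 : ∀ i, I.principalUtil (ω i) = 0 := fun i => by
        simp [hI, hardInstance, hω i]
      simp [h0]
  have hmiss : ∑ o, I.prob o * (1 - I.principalUtil o) = 1 - 1 / (n : ℝ) := by
    rw [Fintype.sum_prod_type, Fintype.sum_bool]
    simp [hI, hardInstance]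
    field_simp
  have hexp : (1 - 1 / (n : ℝ)) ^ n ≤ 1 / 2 := by
    refine (Real.one_sub_div_pow_le_exp_neg hn1).trans ?_
    rw [Real.exp_neg, ← one_div]
    exact one_div_le_one_div_of_le (by norm_num) (by linarith [Real.add_one_le_exp (1 : ℝ)])
  calc (1 / 2 : ℝ) ≤ 1 - (1 - 1 / (n : ℝ)) ^ n := by linarith
    _ = ∑ ω : Fin n → Bool × Fin n,
          (∏ i, I.prob (ω i)) * (1 - ∏ i, (1 - I.principalUtil (ω i))) := by
        simp only [mul_sub, mul_one, ← Finset.prod_mul_distrib]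
        rw [← hmiss, Fintype.sum_pow, Finset.sum_sub_distrib, I.sum_prod_prob]
        simp only [mul_sub, mul_one]
    _ ≤ I.offlineValue := Finset.sum_le_sum fun ω _ =>
        mul_le_mul_of_nonneg_left (hsup ω) (Finset.prod_nonneg fun i _ => I.prob_nonneg _)

end Hard

end OnlineDelegation

theorem mainTheorem8 :
    ∃ C : ℝ, 0 < C ∧ ∀ (n : ℕ) (hn : 1 ≤ n) (k : ℕ), 1 ≤ k →
      ∀ (φ : OnlineDelegation.Scheme (Bool × Fin n))
        (σ : OnlineDelegation.Strategy (Bool × Fin n)),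
        (OnlineDelegation.hardInstance n hn).IsBestResponse k φ σ →
        (OnlineDelegation.hardInstance n hn).principalValue k φ σ ≤
          C * ((k : ℝ) / (n : ℝ)) * (OnlineDelegation.hardInstance n hn).offlineValue := by
  refine ⟨4, by norm_num, fun n hn k hk φ σ h => ?_⟩
  have hopt := OnlineDelegation.half_le_offlineValue hn
  have hk1 : (1 : ℝ) ≤ k := by exact_mod_cast hk
  have hle : (OnlineDelegation.hardInstance n hn).principalValue k φ σ ≤ 2 * k / n := by
    -- For `n = 1` options with `b = 0` have probability zero, so optimality need not pass to every
    -- draw; the trivial bound `1 ≤ 2 * k` suffices.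
    rcases Nat.lt_or_ge n 2 with h1 | h2
    · obtain rfl : n = 1 := by omega
      refine (OnlineDelegation.principalValue_le_one hn k φ σ).trans ?_
      rw [Nat.cast_one, div_one]
      linarith
    · exact OnlineDelegation.principalValue_le hn h2 hk h
  calc _ ≤ 2 * (k : ℝ) / n := hle
    _ = 4 * ((k : ℝ) / n) * (1 / 2) := by ring
    _ ≤ _ := mul_le_mul_of_nonneg_left hopt (by positivity)
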